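/- A Schur partition is a partition into positive parts (the empty partition included) in which, with the parts written in increasing order, consecutive parts differ by at least $3$, and in which no two consecutive multiples $3k,\,3k+3$ of $3$ both occur as parts. For a partition $\pi$ let $m(\pi)$ be the number of its parts plus the number of its even parts. For an integer $N\ge -1$ let $D_N(m,n)$ be the number of Schur partitions $\pi$ of $n$ with $m(\pi)=m$ and all parts at most $N$, and define the Alladi–Schur polynomials $$d_N(x)=\sum_{m,n\ge 0} D_N(m,n)\,x^m q^n\in\mathbb{Z}[q][x],$$ so that in particular $d_{-1}(x)=1$. Put $\lambda(x)=1+xq+x^2q^2$. Then for every integer $N\ge 3$, $$d_{2N-1}(x)=\lambda(x)\Bigl(d_{2N-4}(xq^2)+x\,q^{2N-1}(1-xq)\,d_{2N-7}(xq^2)\Bigr).$$ -/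

import Mathlib

open Polynomial

/-- A Schur partition: listing the parts in increasing order, the gap between consecutive parts
is at least `3`, and no two consecutive multiples `3k`, `3k + 3` of `3` both occur as parts. -/
def IsSchurPartition {n : ℕ} (p : n.Partition) : Prop :=
  (p.parts.sort (· ≤ ·)).IsChain (fun a b => a + 3 ≤ b) ∧
    ∀ a ∈ p.parts, 3 ∣ a → a + 3 ∉ p.parts

instance {n : ℕ} (p : n.Partition) : Decidable (IsSchurPartition p) := by
  unfold IsSchurPartition; infer_instance

/-- The statistic `m(π)`: the number of parts plus the number of even parts. -/
def partsPlusEven {n : ℕ} (p : n.Partition) : ℕ :=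
  p.parts.card + (p.parts.filter (fun a => Even a)).card

/-- The Schur partitions `π` of `n` with `m(π) = m` and all parts at most `N`.
The bound `N` is an integer; for `N ≤ 0` only the empty partition qualifies. -/
def schurSet (N : ℤ) (m n : ℕ) : Finset n.Partition :=
  {p | IsSchurPartition p ∧ partsPlusEven p = m ∧ ∀ a ∈ p.parts, (a : ℤ) ≤ N}

/-- The variable `q` of `ℤ[q][x]`. -/
noncomputable def qv : ℤ[X][X] := C X

/-- The variable `x` of `ℤ[q][x]`. -/
noncomputable def xv : ℤ[X][X] := X

/-- The Alladi-Schur polynomial `d_N(x) = ∑_{m, n ≥ 0} D_N(m, n) x ^ m q ^ n` in `ℤ[q][x]`, where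
`D_N(m, n)` is the cardinality of `schurSet N m n`. Only finitely many terms are nonzero, see
`finite_support_alladiSchur`. -/
noncomputable def alladiSchur (N : ℤ) : ℤ[X][X] :=
  ∑ᶠ mn : ℕ × ℕ, ((schurSet N mn.1 mn.2).card : ℤ[X][X]) * xv ^ mn.1 * qv ^ mn.2

/-- `λ(x) = 1 + xq + x²q²`. -/
noncomputable def lam : ℤ[X][X] := 1 + xv * qv + xv ^ 2 * qv ^ 2

theorem schurSet_bound {N : ℤ} {m n : ℕ} {p : n.Partition} (hp : p ∈ schurSet N m n) :
    m ≤ 2 * n ∧ n ≤ ∑ i ∈ Finset.range (N.toNat + 1), i := by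
  simp only [schurSet, Finset.mem_filter, Finset.mem_univ, true_and] at hp
  obtain ⟨⟨hc, -⟩, hm, hN⟩ := hp
  have hcard : p.parts.card ≤ n := by
    have h := Multiset.card_nsmul_le_sum (s := p.parts) (a := 1) (fun x hx => p.parts_pos hx)
    simpa [p.parts_sum] using h
  have hfilt : (p.parts.filter (fun a => Even a)).card ≤ p.parts.card :=
    Multiset.card_le_card (Multiset.filter_le _ _)
  refine ⟨by unfold partsPlusEven at hm; omega, ?_⟩
  have hlt : (p.parts.sort (· ≤ ·)).IsChain (· < ·) :=
    hc.imp (fun a b h => by omega)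
  have hnd : p.parts.Nodup := by
    have h := (List.isChain_iff_pairwise.1 hlt).imp (fun {a b} h => Nat.ne_of_lt h)
    rw [← Multiset.sort_eq p.parts (· ≤ ·)]
    exact Multiset.coe_nodup.2 h
  have hsum : n = ∑ i ∈ p.parts.toFinset, i := by
    conv_lhs => rw [← p.parts_sum]
    rw [Finset.sum, Multiset.toFinset_val, hnd.dedup, Multiset.map_id']
  rw [hsum]
  refine Finset.sum_le_sum_of_subset (fun a ha => ?_)
  have := hN a (Multiset.mem_toFinset.1 ha)
  rw [Finset.mem_range]
  omega

theorem finite_support_alladiSchur (N : ℤ) :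
    (Function.support fun mn : ℕ × ℕ =>
      ((schurSet N mn.1 mn.2).card : ℤ[X][X]) * xv ^ mn.1 * qv ^ mn.2).Finite := by
  set B := ∑ i ∈ Finset.range (N.toNat + 1), i
  refine ((Set.finite_Iic (2 * B)).prod (Set.finite_Iic B)).subset ?_
  rintro ⟨m, n⟩ h
  have hne : (schurSet N m n).Nonempty := by
    rw [← Finset.card_pos]
    by_contra h0
    exact h (by simp [Nat.eq_zero_of_not_pos h0])
  obtain ⟨p, hp⟩ := hne
  have := schurSet_bound hp
  simp only [Set.mem_prod, Set.mem_Iic]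
  omega

/-! Splitting by whether the largest allowed part `n` occurs gives `d_n = d_{n-1} + w(n) d_{n-3}`,
with `d_{n-4}` in place of `d_{n-3}` when `3 ∣ n` (`schurGen_succ`). The weight `w(n)` depends on
the parity of `n`, so the pattern has period 6. Eliminating even bounds leaves three linear
recurrences between odd bounds (`schurGen_odd_recurrence_*`). The bracket on the right-hand side,
`schurCofactor`, satisfies the same three (`schurCofactor_recurrence_*`). Since `λ(x)` does not
depend on the bound, the factorization propagates from the bounds 5 and 7 to all larger odd bounds.
-/

/-- The Schur condition on a finite set of parts. -/
def IsSchurSet (s : Finset ℕ) : Prop :=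
  ∀ a ∈ s, ∀ b ∈ s, a < b → a + 3 ≤ b ∧ (3 ∣ a → b ≠ a + 3)

instance : DecidablePred IsSchurSet := fun s => by
  unfold IsSchurSet; infer_instance

/-- The Schur sets all of whose elements lie in `[1, n]`. -/
def schurSets (n : ℕ) : Finset (Finset ℕ) :=
  (Finset.Icc 1 n).powerset.filter IsSchurSet

/-- The weight of a part `a`. -/
def partWeight {R : Type*} [CommRing R] (x q : R) (a : ℕ) : R :=
  (if Even a then x ^ 2 else x) * q ^ a

/-- The generating function of Schur sets with elements at most `n`. -/
def schurGen {R : Type*} [CommRing R] (x q : R) (n : ℕ) : R :=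
  ∑ s ∈ schurSets n, ∏ a ∈ s, partWeight x q a

theorem IsSchurSet.mono {s t : Finset ℕ} (h : IsSchurSet t) (hst : s ⊆ t) : IsSchurSet s :=
  fun a ha b hb => h a (hst ha) b (hst hb)

/-- The gap condition allows other parts up to `n - 2`; if `3 ∣ n + 1`, then `n - 2` is the
preceding multiple of 3 and is excluded too. For small `n` truncated subtraction gives the empty
interval, as it should. -/
theorem isSchurSet_insert_succ {s : Finset ℕ} {n : ℕ} (hs : s ⊆ Finset.Icc 1 n) :
    IsSchurSet (insert (n + 1) s) ↔
      IsSchurSet s ∧ s ⊆ Finset.Icc 1 (if 3 ∣ n + 1 then n - 3 else n - 2) := by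
  constructor
  · intro h
    refine ⟨h.mono (Finset.subset_insert _ _), fun a ha => ?_⟩
    have h1 := Finset.mem_Icc.1 (hs ha)
    have h2 := h a (Finset.mem_insert_of_mem ha) (n + 1) (Finset.mem_insert_self _ _) (by omega)
    rw [Finset.mem_Icc]
    split_ifs <;> omega
  · rintro ⟨h, hb⟩ a ha b hb' hab
    rw [Finset.mem_insert] at ha hb'
    rcases ha with rfl | ha
    · rcases hb' with rfl | hb'
      · omega
      · have := Finset.mem_Icc.1 (hs hb')
        omega
    · rcases hb' with rfl | hb'
      · have := Finset.mem_Icc.1 (hb ha)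
        split_ifs at this <;> omega
      · exact h a ha b hb' hab

/-! ### Recurrences in the bound, by residue modulo 6. -/

section Recurrences

variable {R : Type*} [CommRing R] (x q : R)

theorem schurGen_zero : schurGen x q 0 = 1 := by
  have h : schurSets 0 = {∅} := by decide
  simp [schurGen, h]

theorem schurGen_succ (n : ℕ) :
    schurGen x q (n + 1) = schurGen x q n +
      partWeight x q (n + 1) * schurGen x q (if 3 ∣ n + 1 then n - 3 else n - 2) := by
  have hI : Finset.Icc 1 (n + 1) = insert (n + 1) (Finset.Icc 1 n) := by
    ext a; simp only [Finset.mem_Icc, Finset.mem_insert]; omega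
  have hn : n + 1 ∉ Finset.Icc 1 n := by simp
  simp only [schurGen, schurSets, Finset.sum_filter]
  rw [hI, Finset.sum_powerset_insert hn]
  congr 1
  rw [← Finset.sum_filter, ← Finset.sum_filter, Finset.mul_sum]
  have hf : (Finset.Icc 1 n).powerset.filter (fun s => IsSchurSet (insert (n + 1) s)) =
      (Finset.Icc 1 (if 3 ∣ n + 1 then n - 3 else n - 2)).powerset.filter IsSchurSet := by
    ext s
    simp only [Finset.mem_filter, Finset.mem_powerset]
    constructor
    · rintro ⟨hs, h⟩
      exact ((isSchurSet_insert_succ hs).1 h).symm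
    · rintro ⟨hs, h⟩
      have hs' : s ⊆ Finset.Icc 1 n :=
        hs.trans (Finset.Icc_subset_Icc le_rfl (by split_ifs <;> omega))
      exact ⟨hs', (isSchurSet_insert_succ hs').2 ⟨h, hs⟩⟩
  rw [← hf]
  refine Finset.sum_congr rfl fun s hs => ?_
  rw [Finset.mem_filter, Finset.mem_powerset] at hs
  rw [Finset.prod_insert fun h => hn (hs.1 h)]

theorem schurGen_six_mul_add_one (k : ℕ) : schurGen x q (6 * k + 1) =
    schurGen x q (6 * k) + x * q ^ (6 * k + 1) * schurGen x q (6 * k - 2) := by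
  rw [schurGen_succ, if_neg (by omega), partWeight, if_neg (by grind)]

theorem schurGen_six_mul_add_two (k : ℕ) : schurGen x q (6 * k + 2) =
    schurGen x q (6 * k + 1) + x ^ 2 * q ^ (6 * k + 2) * schurGen x q (6 * k - 1) := by
  rw [schurGen_succ, if_neg (by omega), partWeight, if_pos (by grind)]
  congr 3

theorem schurGen_six_mul_add_three (k : ℕ) : schurGen x q (6 * k + 3) =
    schurGen x q (6 * k + 2) + x * q ^ (6 * k + 3) * schurGen x q (6 * k - 1) := by
  rw [schurGen_succ, if_pos (by omega), partWeight, if_neg (by grind)]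
  congr 3

theorem schurGen_six_mul_add_four (k : ℕ) : schurGen x q (6 * k + 4) =
    schurGen x q (6 * k + 3) + x ^ 2 * q ^ (6 * k + 4) * schurGen x q (6 * k + 1) := by
  rw [schurGen_succ, if_neg (by omega), partWeight, if_pos (by grind)]
  congr 3

theorem schurGen_six_mul_add_five (k : ℕ) : schurGen x q (6 * k + 5) =
    schurGen x q (6 * k + 4) + x * q ^ (6 * k + 5) * schurGen x q (6 * k + 2) := by
  rw [schurGen_succ, if_neg (by omega), partWeight, if_neg (by grind)]
  congr 3

theorem schurGen_six_mul_add_six (k : ℕ) : schurGen x q (6 * k + 6) =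
    schurGen x q (6 * k + 5) + x ^ 2 * q ^ (6 * k + 6) * schurGen x q (6 * k + 2) := by
  rw [schurGen_succ, if_pos (by omega), partWeight, if_pos (by grind)]
  congr 3

/-- The cofactor of `1 + x q + x² q²` in the generating function with odd bound `n`. -/
def schurCofactor (n : ℕ) : R :=
  schurGen (x * q ^ 2) q (n - 3) +
    x * q ^ n * (1 - x * q) * schurGen (x * q ^ 2) q (n - 6)

theorem schurGen_six_mul_add_seven (k : ℕ) : schurGen x q (6 * k + 7) =
    schurGen x q (6 * k + 6) + x * q ^ (6 * k + 7) * schurGen x q (6 * k + 4) :=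
  schurGen_six_mul_add_one x q (k + 1)

theorem schurGen_six_mul_add_eight (k : ℕ) : schurGen x q (6 * k + 8) =
    schurGen x q (6 * k + 7) + x ^ 2 * q ^ (6 * k + 8) * schurGen x q (6 * k + 5) :=
  schurGen_six_mul_add_two x q (k + 1)

theorem schurGen_six_mul_add_nine (k : ℕ) : schurGen x q (6 * k + 9) =
    schurGen x q (6 * k + 8) + x * q ^ (6 * k + 9) * schurGen x q (6 * k + 5) :=
  schurGen_six_mul_add_three x q (k + 1)

theorem schurGen_six_mul_add_ten (k : ℕ) : schurGen x q (6 * k + 10) =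
    schurGen x q (6 * k + 9) + x ^ 2 * q ^ (6 * k + 10) * schurGen x q (6 * k + 7) :=
  schurGen_six_mul_add_four x q (k + 1)

/-! ### Recurrences between odd bounds. -/

theorem schurGen_odd_recurrence_zero (k : ℕ) : schurGen x q (6 * k + 9) =
    schurGen x q (6 * k + 7) +
      (x * q ^ (6 * k + 9) + x ^ 2 * q ^ (6 * k + 8)) * schurGen x q (6 * k + 5) := by
  rw [schurGen_six_mul_add_nine, schurGen_six_mul_add_eight]
  ring

theorem schurGen_odd_recurrence_two (k : ℕ) : schurGen x q (6 * k + 11) =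
    schurGen x q (6 * k + 9) +
      (x ^ 2 * q ^ (6 * k + 10) + x * q ^ (6 * k + 11)) * schurGen x q (6 * k + 7) +
      x ^ 3 * q ^ (12 * k + 19) * schurGen x q (6 * k + 5) := by
  have h := schurGen_six_mul_add_five x q (k + 1)
  rw [show 6 * (k + 1) + 5 = 6 * k + 11 by ring, show 6 * (k + 1) + 4 = 6 * k + 10 by ring,
    show 6 * (k + 1) + 2 = 6 * k + 8 by ring] at h
  rw [h, schurGen_six_mul_add_ten, schurGen_six_mul_add_eight]
  ring

theorem schurGen_odd_recurrence_one (k : ℕ) : schurGen x q (6 * k + 13) =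
    schurGen x q (6 * k + 11) + x ^ 2 * q ^ (6 * k + 12) *
      (schurGen x q (6 * k + 7) + x ^ 2 * q ^ (6 * k + 8) * schurGen x q (6 * k + 5)) +
      x * q ^ (6 * k + 13) *
        (schurGen x q (6 * k + 9) + x ^ 2 * q ^ (6 * k + 10) * schurGen x q (6 * k + 7)) := by
  have h7 := schurGen_six_mul_add_seven x q (k + 1)
  have h6 := schurGen_six_mul_add_six x q (k + 1)
  rw [show 6 * (k + 1) + 7 = 6 * k + 13 by ring, show 6 * (k + 1) + 6 = 6 * k + 12 by ring,
    show 6 * (k + 1) + 4 = 6 * k + 10 by ring] at h7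
  rw [show 6 * (k + 1) + 6 = 6 * k + 12 by ring, show 6 * (k + 1) + 5 = 6 * k + 11 by ring,
    show 6 * (k + 1) + 2 = 6 * k + 8 by ring] at h6
  rw [h7, h6, schurGen_six_mul_add_ten, schurGen_six_mul_add_eight]

/-- At `x q²`, every generating function involved reduces to those with bounds `6k + 1` and `6k -
1`; comparing their coefficients is then a polynomial identity. The next two recurrences are proved
the same way. -/
theorem schurCofactor_recurrence_zero (k : ℕ) : schurCofactor x q (6 * k + 9) =
    schurCofactor x q (6 * k + 7) +
      (x * q ^ (6 * k + 9) + x ^ 2 * q ^ (6 * k + 8)) * schurCofactor x q (6 * k + 5) := by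
  -- The subtractions in `schurCofactor` reduce definitionally. At `k = 0` the index `6 * k - 1` is
  -- truncated to 0, which is harmless since `d_{-1} = d_0 = 1`.
  change schurGen _ q (6 * k + 6) + _ * schurGen _ q (6 * k + 3) =
    (schurGen _ q (6 * k + 4) + _ * schurGen _ q (6 * k + 1)) +
      _ * (schurGen _ q (6 * k + 2) + _ * schurGen _ q (6 * k - 1))
  rw [schurGen_six_mul_add_six, schurGen_six_mul_add_five, schurGen_six_mul_add_four,
    schurGen_six_mul_add_three, schurGen_six_mul_add_two]
  ring

theorem schurCofactor_recurrence_two (k : ℕ) : schurCofactor x q (6 * k + 11) =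
    schurCofactor x q (6 * k + 9) +
      (x ^ 2 * q ^ (6 * k + 10) + x * q ^ (6 * k + 11)) * schurCofactor x q (6 * k + 7) +
      x ^ 3 * q ^ (12 * k + 19) * schurCofactor x q (6 * k + 5) := by
  change schurGen _ q (6 * k + 8) + _ * schurGen _ q (6 * k + 5) =
    (schurGen _ q (6 * k + 6) + _ * schurGen _ q (6 * k + 3)) +
      _ * (schurGen _ q (6 * k + 4) + _ * schurGen _ q (6 * k + 1)) +
      _ * (schurGen _ q (6 * k + 2) + _ * schurGen _ q (6 * k - 1))
  rw [schurGen_six_mul_add_eight, schurGen_six_mul_add_seven, schurGen_six_mul_add_six,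
    schurGen_six_mul_add_five, schurGen_six_mul_add_four,
    schurGen_six_mul_add_three, schurGen_six_mul_add_two]
  ring

theorem schurCofactor_recurrence_one (k : ℕ) : schurCofactor x q (6 * k + 13) =
    schurCofactor x q (6 * k + 11) + x ^ 2 * q ^ (6 * k + 12) *
      (schurCofactor x q (6 * k + 7) +
        x ^ 2 * q ^ (6 * k + 8) * schurCofactor x q (6 * k + 5)) +
      x * q ^ (6 * k + 13) *
        (schurCofactor x q (6 * k + 9) +
          x ^ 2 * q ^ (6 * k + 10) * schurCofactor x q (6 * k + 7)) := by
  change schurGen _ q (6 * k + 10) + _ * schurGen _ q (6 * k + 7) =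
    (schurGen _ q (6 * k + 8) + _ * schurGen _ q (6 * k + 5)) +
      _ * ((schurGen _ q (6 * k + 4) + _ * schurGen _ q (6 * k + 1)) +
      _ * (schurGen _ q (6 * k + 2) + _ * schurGen _ q (6 * k - 1))) +
      _ * ((schurGen _ q (6 * k + 6) + _ * schurGen _ q (6 * k + 3)) +
      _ * (schurGen _ q (6 * k + 4) + _ * schurGen _ q (6 * k + 1)))
  rw [schurGen_six_mul_add_ten, schurGen_six_mul_add_nine,
    schurGen_six_mul_add_eight, schurGen_six_mul_add_seven, schurGen_six_mul_add_six,
    schurGen_six_mul_add_five, schurGen_six_mul_add_four,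
    schurGen_six_mul_add_three, schurGen_six_mul_add_two]
  ring

/-! ### Initial values and the induction. -/

theorem schurGen_one : schurGen x q 1 = 1 + x * q := by
  simpa [schurGen_zero] using schurGen_six_mul_add_one x q 0

theorem schurGen_two : schurGen x q 2 = 1 + x * q + x ^ 2 * q ^ 2 := by
  simpa [schurGen_zero, schurGen_one] using schurGen_six_mul_add_two x q 0

theorem schurGen_three : schurGen x q 3 = 1 + x * q + x ^ 2 * q ^ 2 + x * q ^ 3 := by
  simpa [schurGen_zero, schurGen_two] using schurGen_six_mul_add_three x q 0

theorem schurGen_four : schurGen x q 4 =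
    1 + x * q + x ^ 2 * q ^ 2 + x * q ^ 3 + x ^ 2 * q ^ 4 * (1 + x * q) := by
  simpa [schurGen_one, schurGen_three] using schurGen_six_mul_add_four x q 0

theorem schurGen_five_eq :
    schurGen x q 5 = (1 + x * q + x ^ 2 * q ^ 2) * schurCofactor x q 5 := by
  have h : schurGen x q 5 = schurGen x q 4 + x * q ^ 5 * schurGen x q 2 :=
    schurGen_six_mul_add_five x q 0
  simp only [h, schurCofactor, Nat.reduceSub, schurGen_zero, schurGen_two, schurGen_four]
  ring

theorem schurGen_seven_eq :
    schurGen x q 7 = (1 + x * q + x ^ 2 * q ^ 2) * schurCofactor x q 7 := by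
  have h5 : schurGen x q 5 = schurGen x q 4 + x * q ^ 5 * schurGen x q 2 :=
    schurGen_six_mul_add_five x q 0
  have h6 : schurGen x q 6 = schurGen x q 5 + x ^ 2 * q ^ 6 * schurGen x q 2 :=
    schurGen_six_mul_add_six x q 0
  have h7 : schurGen x q 7 = schurGen x q 6 + x * q ^ 7 * schurGen x q 4 :=
    schurGen_six_mul_add_seven x q 0
  simp only [h7, h6, h5, schurCofactor, Nat.reduceSub, schurGen_one, schurGen_two, schurGen_four]
  ring

theorem schurGen_odd_eq_aux (k : ℕ) :
    schurGen x q (6 * k + 5) = (1 + x * q + x ^ 2 * q ^ 2) * schurCofactor x q (6 * k + 5) ∧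
    schurGen x q (6 * k + 7) = (1 + x * q + x ^ 2 * q ^ 2) * schurCofactor x q (6 * k + 7) ∧
    schurGen x q (6 * k + 9) = (1 + x * q + x ^ 2 * q ^ 2) * schurCofactor x q (6 * k + 9) := by
  -- The bound `6k + 9` follows from the two before it, so only 5 and 7 need direct verification.
  have h9 (k : ℕ)
      (h5 : schurGen x q (6 * k + 5) =
        (1 + x * q + x ^ 2 * q ^ 2) * schurCofactor x q (6 * k + 5))
      (h7 : schurGen x q (6 * k + 7) =
        (1 + x * q + x ^ 2 * q ^ 2) * schurCofactor x q (6 * k + 7)) :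
      schurGen x q (6 * k + 9) =
        (1 + x * q + x ^ 2 * q ^ 2) * schurCofactor x q (6 * k + 9) := by
    rw [schurGen_odd_recurrence_zero, schurCofactor_recurrence_zero, h5, h7]
    ring
  induction k with
  | zero =>
    have h5 : schurGen x q (6 * 0 + 5) =
        (1 + x * q + x ^ 2 * q ^ 2) * schurCofactor x q (6 * 0 + 5) := by
      simpa only [Nat.mul_zero, Nat.zero_add] using schurGen_five_eq x q
    have h7 : schurGen x q (6 * 0 + 7) =
        (1 + x * q + x ^ 2 * q ^ 2) * schurCofactor x q (6 * 0 + 7) := by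
      simpa only [Nat.mul_zero, Nat.zero_add] using schurGen_seven_eq x q
    exact ⟨h5, h7, h9 0 h5 h7⟩
  | succ k ih =>
    obtain ⟨i5, i7, i9⟩ := ih
    have i11 : schurGen x q (6 * k + 11) =
        (1 + x * q + x ^ 2 * q ^ 2) * schurCofactor x q (6 * k + 11) := by
      rw [schurGen_odd_recurrence_two, schurCofactor_recurrence_two, i5, i7, i9]
      ring
    have i13 : schurGen x q (6 * k + 13) =
        (1 + x * q + x ^ 2 * q ^ 2) * schurCofactor x q (6 * k + 13) := by
      rw [schurGen_odd_recurrence_one, schurCofactor_recurrence_one, i5, i7, i9, i11]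
      ring
    have e5 : 6 * (k + 1) + 5 = 6 * k + 11 := by ring
    have e7 : 6 * (k + 1) + 7 = 6 * k + 13 := by ring
    have j5 := i11
    have j7 := i13
    rw [← e5] at j5
    rw [← e7] at j7
    exact ⟨j5, j7, h9 (k + 1) j5 j7⟩

/-- The factorization of the generating function of Schur sets with odd bound. -/
theorem schurGen_odd_eq {n : ℕ} (hn : 5 ≤ n) (hodd : Odd n) :
    schurGen x q n = (1 + x * q + x ^ 2 * q ^ 2) * schurCofactor x q n := by
  obtain ⟨h5, h7, h9⟩ := schurGen_odd_eq_aux x q ((n - 5) / 6)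
  have h : n = 6 * ((n - 5) / 6) + 5 ∨ n = 6 * ((n - 5) / 6) + 7 ∨
      n = 6 * ((n - 5) / 6) + 9 := by
    obtain ⟨m, rfl⟩ := hodd
    omega
  rcases h with h | h | h <;> rw [h]
  exacts [h5, h7, h9]

end Recurrences

/-! ### From partitions to finite sets of parts. -/

theorem IsSchurPartition.nodup {n : ℕ} {p : n.Partition} (hp : IsSchurPartition p) :
    p.parts.Nodup := by
  have hlt : (p.parts.sort (· ≤ ·)).IsChain (· < ·) := hp.1.imp (fun a b h => by omega)
  have hnd := (List.isChain_iff_pairwise.1 hlt).imp (fun {a b} h => Nat.ne_of_lt h)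
  rw [← Multiset.sort_eq p.parts (· ≤ ·)]
  exact Multiset.coe_nodup.2 hnd

theorem isSchurPartition_iff {n : ℕ} {p : n.Partition} (hp : p.parts.Nodup) :
    IsSchurPartition p ↔ IsSchurSet p.parts.toFinset := by
  -- Transitivity turns the condition on consecutive parts into one on all pairs.
  have : IsTrans ℕ (fun a b => a + 3 ≤ b) := ⟨fun a b c h h' => by omega⟩
  have hsort : (p.parts.sort (· ≤ ·)).Pairwise (· < ·) :=
    ((Multiset.pairwise_sort p.parts (· ≤ ·)).and
      (Multiset.coe_nodup.1 ((Multiset.sort_eq p.parts (· ≤ ·)).symm ▸ hp))).imp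
        fun h => lt_of_le_of_ne h.1 h.2
  have hmem (a : ℕ) : a ∈ p.parts.sort (· ≤ ·) ↔ a ∈ p.parts := Multiset.mem_sort _
  unfold IsSchurPartition IsSchurSet
  simp only [Multiset.mem_toFinset]
  rw [List.isChain_iff_pairwise]
  constructor
  · rintro ⟨h, h3⟩ a ha b hb hab
    refine ⟨?_, fun h3a hba => h3 a ha h3a (hba ▸ hb)⟩
    have : Std.Symm (fun a b => a + 3 ≤ b ∨ b + 3 ≤ a) := ⟨fun _ _ => Or.symm⟩
    have := (h.imp (S := fun a b => a + 3 ≤ b ∨ b + 3 ≤ a) Or.inl).forall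
      ((hmem a).2 ha) ((hmem b).2 hb) hab.ne
    omega
  · intro h
    refine ⟨hsort.imp_of_mem fun {a b} ha hb hab =>
      (h a ((hmem a).1 ha) b ((hmem b).1 hb) hab).1, fun a ha h3 hb => ?_⟩
    exact (h a ha (a + 3) hb (by omega)).2 h3 rfl

theorem card_schurSet (N : ℤ) (m n : ℕ) :
    (schurSet N m n).card = ((schurSets N.toNat).filter fun s =>
      s.card + (s.filter Even).card = m ∧ ∑ a ∈ s, a = n).card := by
  refine Finset.card_bij (fun p _ => p.parts.toFinset) ?_ ?_ ?_
  · intro p hp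
    simp only [schurSet, Finset.mem_filter, Finset.mem_univ, true_and] at hp
    obtain ⟨hS, hm, hN⟩ := hp
    have hnd := hS.nodup
    simp only [schurSets, Finset.mem_filter, Finset.mem_powerset]
    refine ⟨⟨fun a ha => ?_, (isSchurPartition_iff hnd).1 hS⟩, ?_, ?_⟩
    · rw [Multiset.mem_toFinset] at ha
      have h1 := hN a ha
      have h2 := p.parts_pos ha
      rw [Finset.mem_Icc]
      omega
    · rw [← hm, partsPlusEven, Multiset.toFinset_card_of_nodup hnd, ← Multiset.toFinset_filter,
        Multiset.toFinset_card_of_nodup (hnd.filter _)]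
    · conv_rhs => rw [← p.parts_sum]
      rw [Finset.sum, Multiset.toFinset_val, hnd.dedup, Multiset.map_id']
  · intro p hp p' hp' h
    simp only [schurSet, Finset.mem_filter, Finset.mem_univ, true_and] at hp hp'
    ext1
    have := congrArg Finset.val h
    simpa [Multiset.toFinset_val, hp.1.nodup.dedup, hp'.1.nodup.dedup] using this
  · intro s hs
    simp only [schurSets, Finset.mem_filter, Finset.mem_powerset] at hs
    obtain ⟨⟨hI, hS⟩, hm, hn⟩ := hs
    let p : n.Partition := ⟨s.val, fun {a} ha => (Finset.mem_Icc.1 (hI ha)).1, by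
      rw [← hn, Finset.sum, Multiset.map_id']⟩
    have hps : p.parts.toFinset = s := Finset.val_toFinset s
    refine ⟨p, ?_, hps⟩
    simp only [schurSet, Finset.mem_filter, Finset.mem_univ, true_and]
    refine ⟨(isSchurPartition_iff s.nodup).2 (hps.symm ▸ hS), hm, fun a ha => ?_⟩
    have := Finset.mem_Icc.1 (hI ha)
    omega

theorem prod_partWeight {R : Type*} [CommRing R] (x q : R) (s : Finset ℕ) :
    ∏ a ∈ s, partWeight x q a = x ^ (s.card + (s.filter Even).card) * q ^ ∑ a ∈ s, a := by
  have h (a : ℕ) : partWeight x q a = x * (if Even a then x else 1) * q ^ a := by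
    unfold partWeight; split_ifs <;> ring
  simp only [h, Finset.prod_mul_distrib, Finset.prod_const, Finset.prod_pow_eq_pow_sum s (fun a => a) q,
    pow_add, ← Finset.prod_filter]

theorem alladiSchur_eq_schurGen (N : ℤ) : alladiSchur N = schurGen xv qv N.toNat := by
  let stat : Finset ℕ → ℕ × ℕ := fun s => (s.card + (s.filter Even).card, ∑ a ∈ s, a)
  let T := (schurSets N.toNat).image stat
  have hcard (mn : ℕ × ℕ) : (schurSet N mn.1 mn.2).card =
      ((schurSets N.toNat).filter fun s => stat s = mn).card := by
    rw [card_schurSet]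
    simp only [stat, Prod.ext_iff]
  unfold alladiSchur
  rw [finsum_eq_sum_of_support_subset (s := T)]
  · unfold schurGen
    rw [← Finset.sum_fiberwise_of_maps_to (g := stat) (t := T)
      fun s hs => Finset.mem_image_of_mem _ hs]
    refine Finset.sum_congr rfl fun mn _ => ?_
    rw [hcard, mul_assoc, ← nsmul_eq_mul, ← Finset.sum_const]
    refine Finset.sum_congr rfl fun s hs => ?_
    rw [prod_partWeight, ← (Finset.mem_filter.1 hs).2]
  · intro mn hmn
    have h0 : (schurSet N mn.1 mn.2).card ≠ 0 := fun h => hmn (by simp [h])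
    rw [hcard, Finset.card_ne_zero] at h0
    obtain ⟨s, hs⟩ := h0
    obtain ⟨hs', rfl⟩ := Finset.mem_filter.1 hs
    exact Finset.mem_coe.2 (Finset.mem_image_of_mem _ hs')

/-- Substituting `x q²` for `x` is a ring homomorphism fixing `q`; this is why `schurGen` is defined
over an arbitrary commutative ring. -/
theorem alladiSchur_comp (N : ℤ) :
    (alladiSchur N).comp (xv * qv ^ 2) = schurGen (xv * qv ^ 2) qv N.toNat := by
  rw [alladiSchur_eq_schurGen, ← coe_compRingHom_apply]
  simp only [schurGen, prod_partWeight, map_sum, map_mul, map_pow]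
  simp [xv, qv]

theorem theorem7 (N : ℕ) (hN : 3 ≤ N) :
    alladiSchur (2 * (N : ℤ) - 1) =
      lam * ((alladiSchur (2 * (N : ℤ) - 4)).comp (xv * qv ^ 2) +
        xv * qv ^ (2 * N - 1) * (1 - xv * qv) *
          (alladiSchur (2 * (N : ℤ) - 7)).comp (xv * qv ^ 2)) := by
  rw [alladiSchur_comp, alladiSchur_comp, alladiSchur_eq_schurGen,
    show (2 * (N : ℤ) - 1).toNat = 2 * N - 1 by omega,
    show (2 * (N : ℤ) - 4).toNat = 2 * N - 1 - 3 by omega,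
    -- For `N = 3` both sides are 0, matching `d_{-1} = 1`.
    show (2 * (N : ℤ) - 7).toNat = 2 * N - 1 - 6 by omega]
  exact schurGen_odd_eq xv qv (by omega) ⟨N - 1, by omega⟩
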